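/- Let $G=(V,E)$ be a finite connected undirected simple graph and let $k\ge 2$ be an integer. Let $G$ be given by adjacency lists (listing the neighbours $N(v)$ of each vertex $v$ in any order), and let the vertices be listed in the discovery order of an arbitrary depth-first search of $G$. Consider the following algorithm. It keeps global lists $S,N,F,T$, all initially empty; vertices are appended to and removed from the back of these lists only. $\mathrm{Main}$: visit the vertices $v$ from the back to the front of the depth-first search order. For each $v$: set $S=\{v\}$; let $\ell=|N(v)\setminus F|$ and append the vertices of $N(v)\setminus F$ to $F$; call $\mathrm{Enumerate}(S,N,F,\ell)$; append $v$ to $F$; restore $S$ and $N$ to their values before this iteration; stop if $|V|-|F|<k$. $\mathrm{Enumerate}(S,N,F,\ell)$: set a local variable $\mathit{hasSolution}$ to false. If $|S|=k$, output $S$ and return true. Otherwise, if $|S|+|T|=k$, output $S\cup T$, empty $T$, and set $\mathit{hasSolution}$ to true. Then repeat the following for each of the last $\ell$ vertices of $F$, from the back: remove the last vertex $u$ from $F$, append it to $S$, and set $\ell'=0$. If now $|S|<k$, then (i) for every $w\in N(u)\setminus(S\cup N\cup F)$, append $w$ to $N$ if $w\in T$, and otherwise append $w$ to $F$ and increase $\ell'$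 by one; (ii) if $\mathit{hasSolution}$ is true, increase $\ell'$ by $|N|$ and move all vertices of $N$, one by one from its back, to the end of $F$. Call $\mathrm{Enumerate}(S,N,F,\ell')$; if it returns true, set $\mathit{hasSolution}$ to true, and otherwise append $u$ to $T$. Restore $S$ and $N$ to their values at the beginning of this iteration and append $u$ to $N$. After the last iteration, return $\mathit{hasSolution}$. Then the algorithm outputs exactly the sets $C\subseteq V$ with $|C|=k$ for which the induced subgraph $G[C]$ is connected, and it outputs each such set exactly once. -/

import Mathlib

namespace ConnEnum

/-- `DFSRun G r stack order`: `(stack, order)` is a reachable configuration of a depth-first search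
traversal of `G` started at `r`. The head of `stack` is the vertex being processed and `order`
lists the vertices discovered so far, in the order of their discovery. -/
inductive DFSRun {V : Type*} (G : SimpleGraph V) (r : V) : List V → List V → Prop
  | start : DFSRun G r [r] [r]
  | discover {u w : V} {stack order : List V} (h : DFSRun G r (u :: stack) order)
      (hadj : G.Adj u w) (hnew : w ∉ order) : DFSRun G r (w :: u :: stack) (order ++ [w])
  | backtrack {u : V} {stack order : List V} (h : DFSRun G r (u :: stack) order)
      (hdone : ∀ w, G.Adj u w → w ∈ order) : DFSRun G r stack order

/-- `order` is the discovery order of a completed depth-first search traversal of `G`, from some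
root and with arbitrary choices of the next vertex. -/
def IsDFSOrder {V : Type*} (G : SimpleGraph V) (order : List V) : Prop :=
  ∃ r, DFSRun G r [] order

/-- `adj` is an adjacency-list representation of `G`: `adj v` lists every neighbour of `v` exactly
once, in an arbitrary order. -/
def IsAdjacencyLists {V : Type*} (G : SimpleGraph V) (adj : V → List V) : Prop :=
  ∀ v, (adj v).Nodup ∧ ∀ w, w ∈ adj v ↔ G.Adj v w

/-- The global variables of the algorithm: the lists `S`, `N`, `F`, `T`, and the sequence `out` of
all vertex sets output so far, in chronological order. The algorithm accesses `S`, `N`, `F`, `T`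
only at their back; each of these is stored with its back as the head of the Lean list. -/
structure State (V : Type*) where
  S : List V
  N : List V
  F : List V
  T : List V
  out : List (Finset V)

variable {V : Type*} [DecidableEq V]

/-- The loop over `v ∈ N(u) \ (S ∪ N ∪ F)`, whose vertices are listed in the last argument:
append `v` to `N` if it is in `T`, and otherwise append it to `F` and increment `ℓ'`. -/
def absorb : State V → ℕ → List V → State V × ℕ
  | st, l', [] => (st, l')
  | st, l', v :: vs =>
    if v ∈ st.T then absorb { st with N := v :: st.N } l' vs
    else absorb { st with F := v :: st.F } (l' + 1) vs

/-- Move the vertices of `N`, one by one from its back, to the end of `F`. -/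
def reopen (st : State V) : State V :=
  { st with N := [], F := st.N.reverse ++ st.F }

/-- The part of an iteration of `Enumerate` that prepares the recursive call, after `u` has been
moved from `F` to `S`. It returns the new state and `ℓ'`. -/
def expand (k : ℕ) (adj : V → List V) (u : V) (hasSolution : Bool) (st : State V) :
    State V × ℕ :=
  if st.S.length < k then
    let p := absorb st 0 ((adj u).filter fun v => v ∉ st.S ∧ v ∉ st.N ∧ v ∉ st.F)
    if hasSolution then (reopen p.1, p.2 + p.1.N.length) else p
  else (st, 0)

theorem absorb_S (st : State V) (l' : ℕ) (vs : List V) : (absorb st l' vs).1.S = st.S := by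
  induction vs generalizing st l' with
  | nil => rfl
  | cons v vs ih => unfold absorb; split <;> simp [ih]

theorem expand_S (k : ℕ) (adj : V → List V) (u : V) (b : Bool) (st : State V) :
    (expand k adj u b st).1.S = st.S := by
  unfold expand
  split
  · cases b <;> simp [reopen, absorb_S]
  · rfl

theorem expand_snd (k : ℕ) (adj : V → List V) (u : V) (b : Bool) (st : State V)
    (h : ¬ st.S.length < k) : (expand k adj u b st).2 = 0 := by
  simp [expand, h]

mutual

/-- The recursive procedure `Enumerate(S, N, F, ℓ)`, acting on the global state. It returns the
final state and the returned Boolean. -/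
def enumerate (k : ℕ) (adj : V → List V) (st : State V) (l : ℕ) : State V × Bool :=
  if st.S.length = k then
    ({ st with out := st.out ++ [st.S.toFinset] }, true)
  else if st.S.length + st.T.length = k then
    enumerateLoop k adj
      { st with out := st.out ++ [st.S.toFinset ∪ st.T.toFinset], T := [] } l true
  else
    enumerateLoop k adj st l false
termination_by (k - st.S.length, l, 1)

/-- The main loop of `Enumerate`, with `l` iterations left and the current value of the local
variable `hasSolution`. At the end of an iteration `S` and `N` are restored to their values at its
beginning, and then `u` is appended to `N`. -/
def enumerateLoop (k : ℕ) (adj : V → List V) : State V → ℕ → Bool → State V × Bool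
  | st, 0, hasSolution => (st, hasSolution)
  | st, l + 1, hasSolution =>
    match st.F with
    | [] => (st, hasSolution)
    | u :: F =>
      let p := expand k adj u hasSolution { st with F := F, S := u :: st.S }
      let q := enumerate k adj p.1 p.2
      let T := if q.2 then q.1.T else u :: q.1.T
      enumerateLoop k adj { q.1 with S := st.S, N := u :: st.N, T := T } l (hasSolution || q.2)
termination_by st l _ => (k - st.S.length, l, 0)
decreasing_by
  · have hS := expand_S k adj u hasSolution { st with F := F, S := u :: st.S }
    have h0 := expand_snd k adj u hasSolution { st with F := F, S := u :: st.S }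
    simp only [List.length_cons] at hS h0
    rw [hS, List.length_cons]
    by_cases h : st.S.length + 1 < k
    · exact Prod.Lex.left _ _ (by omega)
    · rw [h0 h]
      by_cases h' : k - (st.S.length + 1) < k - st.S.length
      · exact Prod.Lex.left _ _ h'
      · have hk : k - (st.S.length + 1) = k - st.S.length := by omega
        rw [hk]
        exact Prod.Lex.right _ (Prod.Lex.left _ _ (Nat.succ_pos l))
  · exact Prod.Lex.right _ (Prod.Lex.left _ _ (by omega))

end

/-- The loop of `Main` over the vertices still to be visited, given in the order of visiting; `n` is
the number of vertices of the graph. -/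
def mainLoop (k : ℕ) (adj : V → List V) (n : ℕ) : State V → List V → State V
  | st, [] => st
  | st, v :: vs =>
    let new := (adj v).filter fun u => u ∉ st.F
    let st₁ := (enumerate k adj { st with S := [v], F := new.reverse ++ st.F } new.length).1
    let st₂ := { st₁ with F := v :: st₁.F, S := st.S, N := st.N }
    if n < k + st₂.F.length then st₂ else mainLoop k adj n st₂ vs

/-- The procedure `Main`, on a graph given by its adjacency lists `adj` and the list `order` of its
vertices, which is visited from back to front. Its value is the sequence of all vertex sets that
are output, in chronological order. -/
def main (k : ℕ) (adj : V → List V) (order : List V) : List (Finset V) :=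
  (mainLoop k adj order.length ⟨[], [], [], [], []⟩ order.reverse).out

end ConnEnum

/-!
Branching on a neighbour `u` of the current connected set `S` splits the connected `k`-sets that
contain `S` and avoid `F` into those that contain `u` and those that avoid it, so every set is
output at most once. No branch reaches a set that avoids all branching vertices, and the list `T`
accounts for these: as long as no solution has been found for `S`, the set `S ∪ T` is the component
of `S` after the deletion of the vertices still in `F`, so there is no solution avoiding them while
`|S ∪ T| < k`, and exactly one, `S ∪ T` itself, when `|S ∪ T| = k`. After the first solution `T`
stays empty: adding a neighbour `u` of `S` to a solution and discarding a surplus vertex outside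
`S ∪ {u}` gives a solution that contains `u`, so no later call fails. In `Main` the vertices that
remain together with `v` are an initial segment of the search order and so form a connected set; if
there are at least `k` of them, the call at `v` succeeds.
-/

namespace ConnEnum

section Connectivity

variable {V : Type*} {G : SimpleGraph V}

theorem connected_induce_congr {C D : Set V} (h : ∀ x, x ∈ C ↔ x ∈ D) :
    (G.induce C).Connected ↔ (G.induce D).Connected := by
  rw [Set.ext h]

theorem connected_induce_singleton (v : V) : (G.induce ({v} : Set V)).Connected := by
  rw [SimpleGraph.induce_singleton_eq_top]
  exact SimpleGraph.connected_top

theorem connected_induce_mem_singleton (v : V) : (G.induce {x | x ∈ [v]}).Connected :=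
  (connected_induce_congr fun _ => List.mem_singleton).2 (connected_induce_singleton v)

theorem connected_induce_insert {C : Set V} {c u : V} (hC : (G.induce C).Connected) (hc : c ∈ C)
    (hcu : G.Adj c u) : (G.induce (insert u C)).Connected := by
  rw [← Set.union_singleton]
  exact SimpleGraph.connected_induce_union hC.preconnected
    (connected_induce_singleton u).preconnected hc rfl hcu

theorem connected_induce_cons {A : List V} {a u : V} (hA : (G.induce {x | x ∈ A}).Connected)
    (ha : a ∈ A) (hau : G.Adj a u) : (G.induce {x | x ∈ u :: A}).Connected :=
  (connected_induce_congr fun _ => List.mem_cons).2 (connected_induce_insert hA ha hau)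

theorem exists_adj_of_connected_induce {C A : Set V} (hC : (G.induce C).Connected) {a b : V}
    (haC : a ∈ C) (haA : a ∈ A) (hbC : b ∈ C) (hbA : b ∉ A) :
    ∃ x ∈ A, ∃ y ∈ C, y ∉ A ∧ G.Adj x y := by
  obtain ⟨p⟩ := hC.preconnected ⟨a, haC⟩ ⟨b, hbC⟩
  obtain ⟨d, -, hfst, hsnd⟩ := p.exists_boundary_dart (Subtype.val ⁻¹' A) haA hbA
  exact ⟨d.fst, hfst, d.snd, d.snd.2, hsnd, d.adj⟩

theorem exists_connected_induce_card_eq {A D : Finset V} {m : ℕ}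
    (hA : (G.induce (A : Set V)).Connected) (hD : (G.induce (D : Set V)).Connected)
    (hAD : A ⊆ D) (hAm : A.card ≤ m) (hmD : m ≤ D.card) :
    ∃ B : Finset V, A ⊆ B ∧ B ⊆ D ∧ B.card = m ∧ (G.induce (B : Set V)).Connected := by
  classical
  induction m, hAm using Nat.le_induction with
  | base => exact ⟨A, subset_rfl, hAD, rfl, hA⟩
  | succ m _ ih =>
    obtain ⟨B, hAB, hBD, hBm, hB⟩ := ih (by omega)
    obtain ⟨b, hbD, hbB⟩ := Finset.exists_mem_notMem_of_card_lt_card (s := B) (t := D) (by omega)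
    obtain ⟨⟨a, ha⟩⟩ := hB.nonempty
    obtain ⟨x, hx, y, hy, hyB, hxy⟩ := exists_adj_of_connected_induce hD (hBD ha) ha hbD hbB
    refine ⟨insert y B, hAB.trans (Finset.subset_insert y B), Finset.insert_subset hy hBD, ?_, ?_⟩
    · rw [Finset.card_insert_of_notMem hyB, hBm]
    · rw [Finset.coe_insert]
      exact connected_induce_insert hB hx hxy

end Connectivity

section ConnectedOrder

variable {V : Type*} {G : SimpleGraph V}

/-- A connected ordering: a list of distinct vertices of `G` of which every nonempty initial segment
induces a connected subgraph. This is what the algorithm needs to know about a search order. -/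
structure IsConnectedOrder (G : SimpleGraph V) (l : List V) : Prop where
  nodup : l.Nodup
  connected : ∀ p, p <+: l → p ≠ [] → (G.induce {x | x ∈ p}).Connected

theorem isConnectedOrder_singleton (v : V) : IsConnectedOrder G [v] where
  nodup := List.nodup_singleton v
  connected p hp hne := by
    obtain rfl : p = [v] := (List.prefix_concat_iff (l₂ := [])).1 hp |>.resolve_right
      fun h => hne (List.prefix_nil.1 h)
    exact connected_induce_mem_singleton v

theorem IsConnectedOrder.concat {l : List V} {u w : V} (hl : IsConnectedOrder G l) (hu : u ∈ l)
    (huw : G.Adj u w) (hw : w ∉ l) : IsConnectedOrder G (l ++ [w]) where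
  nodup := List.nodup_append'.2 ⟨hl.nodup, List.nodup_singleton w, by simpa using hw⟩
  connected p hp hne := by
    rcases List.prefix_concat_iff.1 hp with rfl | hp
    · have hconn := hl.connected l List.prefix_rfl (List.ne_nil_of_mem hu)
      exact (connected_induce_congr fun _ => (List.perm_append_singleton w l).mem_iff).2
        (connected_induce_cons hconn hu huw)
    · exact hl.connected p hp hne

theorem IsConnectedOrder.of_prefix {l l' : List V} (hl : IsConnectedOrder G l) (h : l' <+: l) :
    IsConnectedOrder G l' :=
  ⟨hl.nodup.sublist h.sublist, fun p hp => hl.connected p (hp.trans h)⟩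

theorem DFSRun.root_mem {r : V} {stack order : List V} (h : DFSRun G r stack order) :
    r ∈ order := by
  induction h with
  | start => exact List.mem_singleton_self r
  | discover _ _ _ ih => exact List.mem_append_left _ ih
  | backtrack _ _ ih => exact ih

theorem DFSRun.stack_subset {r : V} {stack order : List V} (h : DFSRun G r stack order) :
    stack ⊆ order := by
  induction h with
  | start => exact List.Subset.refl _
  | discover _ _ _ ih => grind
  | backtrack _ _ ih => exact (List.cons_subset.1 ih).2

theorem DFSRun.mem_of_adj {r : V} {stack order : List V} (h : DFSRun G r stack order) :
    ∀ x ∈ order, x ∉ stack → ∀ w, G.Adj x w → w ∈ order := by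
  induction h with
  | start => simp
  | discover _ _ _ ih => grind
  | backtrack _ _ ih => grind

theorem DFSRun.isConnectedOrder {r : V} {stack order : List V} (h : DFSRun G r stack order) :
    IsConnectedOrder G order := by
  induction h with
  | start => exact isConnectedOrder_singleton r
  | discover h hadj hnew ih => exact ih.concat (h.stack_subset List.mem_cons_self) hadj hnew
  | backtrack _ _ ih => exact ih

theorem IsDFSOrder.isConnectedOrder {order : List V} (h : IsDFSOrder G order) :
    IsConnectedOrder G order :=
  let ⟨_, hrun⟩ := h
  hrun.isConnectedOrder

theorem IsDFSOrder.mem {order : List V} (h : IsDFSOrder G order) (hG : G.Connected) (v : V) :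
    v ∈ order := by
  obtain ⟨r, hrun⟩ := h
  obtain ⟨p⟩ := hG.preconnected r v
  by_contra hv
  obtain ⟨d, -, hfst, hsnd⟩ := p.exists_boundary_dart {x | x ∈ order} hrun.root_mem hv
  exact hsnd (hrun.mem_of_adj _ hfst List.not_mem_nil _ d.adj)

end ConnectedOrder

section Component

variable {V : Type*} {G : SimpleGraph V}

/-- `A` lists, without repetition, the vertices of a connected component of the graph obtained from
`G` by deleting the vertices in `F`, a list without repetition as well. -/
structure IsComponent (G : SimpleGraph V) (A F : List V) : Prop where
  connected : (G.induce {x | x ∈ A}).Connected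
  nodup : (A ++ F).Nodup
  closed : ∀ a ∈ A, ∀ x, G.Adj a x → x ∈ A ∨ x ∈ F

theorem IsComponent.ne_nil {A F : List V} (h : IsComponent G A F) : A ≠ [] := by
  obtain ⟨⟨a, ha⟩⟩ := h.connected.nonempty
  exact List.ne_nil_of_mem ha

theorem IsComponent.perm {A A' F F' : List V} (h : IsComponent G A F) (hA : A.Perm A')
    (hF : F.Perm F') : IsComponent G A' F' where
  connected := (connected_induce_congr fun _ => hA.mem_iff).1 h.connected
  nodup := (hA.append hF).nodup_iff.1 h.nodup
  closed := by simpa only [hA.mem_iff, hF.mem_iff] using h.closed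

theorem isComponent_singleton {v : V} {W F : List V} (hF : F.Nodup) (hv : v ∉ F) (hW : W.Nodup)
    (hmem : ∀ x, x ∈ W ↔ G.Adj v x ∧ x ∉ F) : IsComponent G [v] (W ++ F) where
  connected := connected_induce_mem_singleton v
  nodup := by
    have hvv : ¬ G.Adj v v := G.irrefl
    simp only [List.nodup_append, List.nodup_cons, List.mem_append]
    grind
  closed := by grind

theorem IsComponent.cons {A W F : List V} {a u : V} (h : IsComponent G A (u :: F)) (ha : a ∈ A)
    (hau : G.Adj a u) (hW : W.Nodup) (hmem : ∀ x, x ∈ W ↔ G.Adj u x ∧ x ∉ u :: A ∧ x ∉ F) :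
    IsComponent G (u :: A) (W ++ F) where
  connected := connected_induce_cons h.connected ha hau
  nodup := by
    have hnodup := h.nodup
    simp only [List.nodup_append, List.nodup_cons, List.mem_append] at hnodup ⊢
    grind
  closed := by
    have hclosed := h.closed
    grind

theorem IsComponent.mem_of_connected {A F : List V} (h : IsComponent G A F) {C : Set V}
    (hC : (G.induce C).Connected) (hCF : ∀ x ∈ F, x ∉ C) {a : V} (haA : a ∈ A) (haC : a ∈ C) {x : V}
    (hx : x ∈ C) : x ∈ A := by
  by_contra hxA
  obtain ⟨y, hy, z, hz, hzA, hyz⟩ :=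
    exists_adj_of_connected_induce (A := {x | x ∈ A}) hC haC haA hx hxA
  exact (h.closed y hy z hyz).elim hzA fun hzF => hCF z hzF hz

end Component

section Solutions

variable {V : Type*} {G : SimpleGraph V} {k : ℕ}

/-- The connected `k`-sets that contain `S` and avoid `F`: the sets that a call of `Enumerate` with
the current list `S` has to output, where `F` lists the vertices it may not use. -/
def solutions (G : SimpleGraph V) (k : ℕ) (S F : List V) : Set (Finset V) :=
  {C | (∀ x ∈ S, x ∈ C) ∧ (∀ x ∈ F, x ∉ C) ∧ C.card = k ∧ (G.induce (C : Set V)).Connected}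

theorem mem_solutions_nil_nil {C : Finset V} :
    C ∈ solutions G k [] [] ↔ C.card = k ∧ (G.induce (C : Set V)).Connected := by
  simp [solutions]

theorem solutions_anti {S S' F F' : List V} (hS : S ⊆ S') (hF : F ⊆ F') :
    solutions G k S' F' ⊆ solutions G k S F :=
  fun _ ⟨hSC, hFC, h⟩ => ⟨fun x hx => hSC x (hS hx), fun x hx => hFC x (hF hx), h⟩

theorem solutions_cons_union_solutions_cons (S F : List V) (u : V) :
    solutions G k (u :: S) F ∪ solutions G k S (u :: F) = solutions G k S F := by
  ext C
  simp only [solutions, Set.mem_union, Set.mem_ofPred_eq, List.forall_mem_cons]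
  tauto

theorem disjoint_solutions_cons (S S' F F' : List V) (u : V) :
    Disjoint (solutions G k (u :: S) F) (solutions G k S' (u :: F')) :=
  Set.disjoint_left.2 fun _ hu hu' => hu'.2.1 u List.mem_cons_self (hu.1 u List.mem_cons_self)

theorem solutions_sdiff_solutions_cons (S R F : List V) (u : V) (hFR : F ⊆ R) :
    solutions G k S F \ solutions G k S (u :: R) =
      solutions G k (u :: S) R ∪ solutions G k S F \ solutions G k S R := by
  have hsplit := solutions_cons_union_solutions_cons (G := G) (k := k) S R u
  have hdisj := disjoint_solutions_cons (G := G) (k := k) S S R R u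
  have hsub : solutions G k S R ⊆ solutions G k S F := solutions_anti (List.Subset.refl S) hFR
  grind

theorem solutions_eq_empty_of_length_lt {S F l : List V}
    (hl : ∀ C ∈ solutions G k S F, ∀ x ∈ C, x ∈ l) (hlk : l.length < k) :
    solutions G k S F = ∅ := by
  classical
  refine Set.eq_empty_of_forall_notMem fun C hC => ?_
  have hCl : C ⊆ l.toFinset := fun x hx => List.mem_toFinset.2 (hl C hC x hx)
  have hcard := (Finset.card_le_card hCl).trans l.toFinset_card_le
  exact absurd hC.2.2.1 (by omega)

theorem solutions_eq_empty_of_forall_mem_or_mem {S F l : List V} (hFl : ∀ x, x ∈ F ∨ x ∈ l)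
    (hlk : l.length < k) : solutions G k S F = ∅ :=
  solutions_eq_empty_of_length_lt
    (fun _ hC x hx => (hFl x).resolve_left fun hxF => hC.2.1 x hxF hx) hlk

theorem toFinset_mem_solutions [DecidableEq V] {S A F : List V}
    (hA : (G.induce {x | x ∈ A}).Connected) (hAF : (A ++ F).Nodup) (hSA : S ⊆ A)
    (hAk : A.length = k) : A.toFinset ∈ solutions G k S F := by
  obtain ⟨hAnodup, -, hdisj⟩ := List.nodup_append'.1 hAF
  refine ⟨fun x hx => List.mem_toFinset.2 (hSA hx), fun x hxF hxA => ?_, ?_, ?_⟩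
  · exact hdisj (List.mem_toFinset.1 hxA) hxF
  · rw [List.toFinset_card_of_nodup hAnodup, hAk]
  · rwa [List.coe_toFinset]

theorem solutions_eq_singleton_of_length_eq [DecidableEq V] {S F : List V}
    (hS : (G.induce {x | x ∈ S}).Connected) (hSF : (S ++ F).Nodup) (hSk : S.length = k) :
    solutions G k S F = {S.toFinset} := by
  have hmem := toFinset_mem_solutions hS hSF (List.Subset.refl S) hSk
  refine Set.eq_singleton_iff_unique_mem.2 ⟨hmem, fun C ⟨hSC, _, hCk, _⟩ => ?_⟩
  exact (Finset.eq_of_subset_of_card_le (fun x hx => hSC x (List.mem_toFinset.1 hx))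
    (hCk.trans hmem.2.2.1.symm).le).symm

theorem IsComponent.subset_of_mem_solutions {S A F : List V} (h : IsComponent G A F) (hSA : S ⊆ A)
    (hS : S ≠ []) {C : Finset V} (hC : C ∈ solutions G k S F) : ∀ x ∈ C, x ∈ A := by
  obtain ⟨s, hs⟩ := List.exists_mem_of_ne_nil S hS
  obtain ⟨hSC, hFC, -, hCconn⟩ := hC
  exact fun x hx => h.mem_of_connected hCconn hFC (hSA hs) (hSC s hs) hx

theorem IsComponent.solutions_eq_empty {S A F : List V} (h : IsComponent G A F) (hSA : S ⊆ A)
    (hS : S ≠ []) (hAk : A.length < k) : solutions G k S F = ∅ :=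
  solutions_eq_empty_of_length_lt (fun _ hC => h.subset_of_mem_solutions hSA hS hC) hAk

theorem IsComponent.solutions_eq_singleton [DecidableEq V] {S A F : List V} (h : IsComponent G A F)
    (hSA : S ⊆ A) (hS : S ≠ []) (hAk : A.length = k) : solutions G k S F = {A.toFinset} := by
  have hmem := toFinset_mem_solutions h.connected h.nodup hSA hAk
  refine Set.eq_singleton_iff_unique_mem.2 ⟨hmem, fun C hC => ?_⟩
  exact Finset.eq_of_subset_of_card_le
    (fun x hx => List.mem_toFinset.2 (h.subset_of_mem_solutions hSA hS hC x hx))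
    (hmem.2.2.1.trans hC.2.2.1.symm).le

theorem nonempty_solutions_cons {S R : List V} {s u : V} (hS : (G.induce {x | x ∈ S}).Connected)
    (hs : s ∈ S) (hsu : G.Adj s u) (huR : u ∉ R) (hk : S.length < k)
    (hne : (solutions G k S (u :: R)).Nonempty) : (solutions G k (u :: S) R).Nonempty := by
  -- If `D` is a solution, then so is each connected `k`-set between `S ∪ {u}` and `D ∪ {u}`.
  classical
  obtain ⟨D, hSD, hFD, hDk, hD⟩ := hne
  have hSu : (G.induce ((u :: S).toFinset : Set V)).Connected := by
    rw [List.coe_toFinset]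
    exact connected_induce_cons hS hs hsu
  have hDu : (G.induce (insert u D : Finset V)).Connected := by
    rw [Finset.coe_insert]
    exact connected_induce_insert hD (hSD s hs) hsu
  have hsub : (u :: S).toFinset ⊆ insert u D := by
    rw [List.toFinset_cons]
    exact Finset.insert_subset_insert u fun x hx => hSD x (List.mem_toFinset.1 hx)
  obtain ⟨B, hSB, hBD, hBk, hB⟩ := exists_connected_induce_card_eq hSu hDu hsub
    ((u :: S).toFinset_card_le.trans hk) (hDk.symm.le.trans (Finset.card_le_card (by simp)))
  refine ⟨B, fun x hx => hSB (List.mem_toFinset.2 hx), fun x hxR hxB => ?_, hBk, hB⟩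
  rcases Finset.mem_insert.1 (hBD hxB) with rfl | hxD
  · exact huR hxR
  · exact hFD x (List.mem_cons_of_mem u hxR) hxD

end Solutions

section Invariants

variable {V : Type*} {G : SimpleGraph V} {k : ℕ}

/-- The invariant on the frontier of the current list `S`: the algorithm's list `F` is `L ++ F`,
where `L` lists the vertices that are still to be branched on, and `N ++ L` consists of neighbours
of `S`. -/
structure IsFrontier (G : SimpleGraph V) (S N L F : List V) : Prop where
  component : IsComponent G S (N ++ L ++ F)
  adj : ∀ x ∈ N ++ L, ∃ s ∈ S, G.Adj s x

theorem IsFrontier.adj_head {S N L F : List V} {u : V} (h : IsFrontier G S N (u :: L) F) :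
    ∃ s ∈ S, G.Adj s u :=
  h.adj u (by simp)

theorem IsFrontier.shift {S N L F : List V} {u : V} (h : IsFrontier G S N (u :: L) F) :
    IsFrontier G S (u :: N) L F where
  component := h.component.perm (List.Perm.refl S) (by simp)
  adj x hx := h.adj x (List.perm_middle.mem_iff.2 hx)

theorem IsFrontier.reopen {S N L F : List V} (h : IsFrontier G S N L F) :
    IsFrontier G S [] (N.reverse ++ L) F where
  component := h.component.perm (List.Perm.refl S) <| by
    simpa using (N.reverse_perm.symm.append_right (L ++ F))
  adj x hx := h.adj x (by simpa using hx)

theorem IsFrontier.push {S N L F W A B : List V} {u : V} (h : IsFrontier G S N (u :: L) F)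
    (hW : W.Nodup) (hmem : ∀ x, x ∈ W ↔ G.Adj u x ∧ x ∉ u :: S ∧ x ∉ N ∧ x ∉ L ++ F)
    (hAB : (A ++ B).Perm W) : IsFrontier G (u :: S) (A ++ N) B (L ++ F) where
  component := by
    obtain ⟨s, hs, hsu⟩ := h.adj_head
    have hcomp := (h.component.perm (F' := u :: (N ++ (L ++ F))) (List.Perm.refl S) (by simp)).cons
      hs hsu hW (by grind)
    refine hcomp.perm (List.Perm.refl _) ((hAB.symm.append_right _).trans ?_)
    simpa using (List.perm_append_comm_assoc B N (L ++ F)).append_left A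
  adj x hx := by
    obtain ⟨s, hs, hsx⟩ | hux : (∃ s ∈ S, G.Adj s x) ∨ G.Adj u x := by
      have hadj := h.adj x
      have hAB := hAB.mem_iff (a := x)
      grind
    · exact ⟨s, List.mem_cons_of_mem u hs, hsx⟩
    · exact ⟨u, List.mem_cons_self, hux⟩

theorem IsFrontier.subset_of_isComponent {S N L F T : List V} (h : IsFrontier G S N L F)
    (hT : IsComponent G (S ++ T) (L ++ F)) : N ⊆ T := by
  intro x hx
  obtain ⟨s, hs, hsx⟩ := h.adj x (List.mem_append_left L hx)
  have hclosed := hT.closed s (List.mem_append_left T hs) x hsx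
  have hnodup := h.component.nodup
  simp only [List.nodup_append, List.mem_append] at hnodup
  grind

theorem IsFrontier.isComponent_of_nil {S L F : List V} (h : IsFrontier G S [] L F) :
    IsComponent G (S ++ []) (L ++ F) := by
  simpa using h.component

/-- `Verdict G k S F T b` says that `b` correctly tells whether there is a connected `k`-set that
contains `S` and avoids `F`, and that `T` is as the algorithm keeps it in either case: empty, or the
complement of `S` in its component of `G - F`, which then has fewer than `k` vertices. -/
inductive Verdict (G : SimpleGraph V) (k : ℕ) (S F : List V) : List V → Bool → Prop
  | success (hne : (solutions G k S F).Nonempty) : Verdict G k S F [] true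
  | failure {T : List V} (hT : IsComponent G (S ++ T) F) (hlt : (S ++ T).length < k) :
      Verdict G k S F T false

theorem Verdict.length_add_length_lt {S F T : List V} {b : Bool} (h : Verdict G k S F T b)
    (hS : S.length < k) : S.length + T.length < k := by
  cases h with
  | success _ => exact hS
  | failure _ hlt => rwa [← List.length_append]

theorem Verdict.eq_nil {S F T l : List V} {b : Bool} {s : V} (h : Verdict G k S F T b)
    (hl : (G.induce {x | x ∈ l}).Connected) (hnodup : l.Nodup) (hlF : ∀ x ∈ F, x ∉ l) (hs : s ∈ S)
    (hsl : s ∈ l) (hlk : k ≤ l.length) : T = [] := by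
  cases h with
  | success _ => rfl
  | failure hT hlt =>
    have hsub : l ⊆ S ++ T := fun x hx =>
      hT.mem_of_connected hl hlF (List.mem_append_left T hs) hsl hx
    exact absurd (hnodup.subperm hsub).length_le (by omega)

theorem IsFrontier.verdict_step {S N L F T T' : List V} {u : V} {b b' : Bool}
    (h : IsFrontier G S N (u :: L) F) (hS : S.length < k) (hb : Verdict G k S (u :: (L ++ F)) T b)
    (hb' : Verdict G k (u :: S) (L ++ F) T' b') :
    Verdict G k S (L ++ F) (if b' then T' else u :: T') (b || b') := by
  cases hb' with
  | success hne =>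
    rw [Bool.or_true]
    exact .success (hne.mono (solutions_anti (List.subset_cons_self u S) (List.Subset.refl _)))
  | failure hT' hlt =>
    cases hb with
    | failure _ _ =>
      have hperm : (u :: S ++ T').Perm (S ++ u :: T') := List.perm_middle.symm
      exact .failure (hT'.perm hperm (List.Perm.refl _)) (hperm.length_eq ▸ hlt)
    | success hne =>
      -- Once a solution is known, `nonempty_solutions_cons` excludes a failing call.
      obtain ⟨s, hs, hsu⟩ := h.adj_head
      have huR : u ∉ L ++ F := by
        have hnodup := h.component.nodup
        simp only [List.nodup_append, List.nodup_cons, List.mem_append] at hnodup ⊢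
        grind
      have hsol := nonempty_solutions_cons h.component.connected hs hsu huR hS hne
      rw [hT'.solutions_eq_empty (List.subset_append_left _ _) (List.cons_ne_nil u S) hlt] at hsol
      exact absurd hsol Set.not_nonempty_empty

end Invariants

section Outputs

variable {V : Type*}

/-- The output sequence `out'` arises from `out` by appending exactly the sets in `P`, each of them
once. -/
def Outputs (P : Set (Finset V)) (out out' : List (Finset V)) : Prop :=
  ∃ new, out' = out ++ new ∧ new.Nodup ∧ ∀ C, C ∈ new ↔ C ∈ P

theorem outputs_empty (out : List (Finset V)) : Outputs ∅ out out :=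
  ⟨[], by simp⟩

theorem outputs_singleton (C : Finset V) (out : List (Finset V)) : Outputs {C} out (out ++ [C]) :=
  ⟨[C], by simp⟩

theorem Outputs.trans {P Q : Set (Finset V)} {out₁ out₂ out₃ : List (Finset V)}
    (hP : Outputs P out₁ out₂) (hQ : Outputs Q out₂ out₃) (hPQ : Disjoint P Q) :
    Outputs (P ∪ Q) out₁ out₃ := by
  obtain ⟨newP, rfl, hPnodup, hPmem⟩ := hP
  obtain ⟨newQ, rfl, hQnodup, hQmem⟩ := hQ
  refine ⟨newP ++ newQ, List.append_assoc _ _ _, List.nodup_append'.2 ⟨hPnodup, hQnodup, ?_⟩, ?_⟩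
  · exact fun C hCP hCQ => Set.disjoint_left.1 hPQ ((hPmem C).1 hCP) ((hQmem C).1 hCQ)
  · simp [hPmem, hQmem]

end Outputs

section Enumerate

variable {V : Type*} [DecidableEq V] {G : SimpleGraph V} {k : ℕ} {adj : V → List V}

theorem absorb_eq (st : State V) (l : ℕ) (vs : List V) :
    absorb st l vs =
      ({ st with
          N := (vs.filter (· ∈ st.T)).reverse ++ st.N
          F := (vs.filter (· ∉ st.T)).reverse ++ st.F },
        l + (vs.filter (· ∉ st.T)).length) := by
  induction vs generalizing st l with
  | nil => simp [absorb]
  | cons v vs ih => by_cases hv : v ∈ st.T <;> simp [absorb, ih, hv, Nat.add_assoc, Nat.add_comm 1]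

theorem expand_false {S N F T W : List V} {out : List (Finset V)} {u : V} (hS : S.length < k)
    (hW : (adj u).filter (fun v => v ∉ S ∧ v ∉ N ∧ v ∉ F) = W) :
    expand k adj u false ⟨S, N, F, T, out⟩ =
      (⟨S, (W.filter (· ∈ T)).reverse ++ N, (W.filter (· ∉ T)).reverse ++ F, T, out⟩,
        (W.filter (· ∉ T)).reverse.length) := by
  subst hW
  simp only [expand, if_pos hS, absorb_eq, Bool.false_eq_true, if_false, Nat.zero_add,
    List.length_reverse]

theorem expand_true {S N F T W : List V} {out : List (Finset V)} {u : V} (hS : S.length < k)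
    (hW : (adj u).filter (fun v => v ∉ S ∧ v ∉ N ∧ v ∉ F) = W) :
    expand k adj u true ⟨S, N, F, T, out⟩ =
      (⟨S, [], ((W.filter (· ∈ T)).reverse ++ N).reverse ++ ((W.filter (· ∉ T)).reverse ++ F), T,
          out⟩,
        (((W.filter (· ∈ T)).reverse ++ N).reverse ++ (W.filter (· ∉ T)).reverse).length) := by
  subst hW
  simp only [expand, if_pos hS, absorb_eq, reopen, if_true, Nat.zero_add, List.length_append,
    List.length_reverse, Nat.add_comm]

theorem expand_of_not_lt {st : State V} {u : V} {b : Bool} (hS : ¬ st.S.length < k) :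
    expand k adj u b st = (st, 0) :=
  if_neg hS

theorem IsFrontier.exists_expand_eq (hadj : IsAdjacencyLists G adj) {S N L F T : List V}
    {out : List (Finset V)} {u : V} {b : Bool} (h : IsFrontier G S N (u :: L) F)
    (hb : Verdict G k S (u :: (L ++ F)) T b) (hk : S.length + 1 < k) :
    ∃ N' L', expand k adj u b ⟨u :: S, N, L ++ F, T, out⟩ =
        (⟨u :: S, N', L' ++ (L ++ F), T, out⟩, L'.length) ∧
      IsFrontier G (u :: S) N' L' (L ++ F) ∧
      IsComponent G (u :: S ++ T) (L' ++ (L ++ F)) := by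
  obtain ⟨hnodup, hmem⟩ := hadj u
  obtain ⟨W, hW⟩ : ∃ W, (adj u).filter (fun v => v ∉ u :: S ∧ v ∉ N ∧ v ∉ L ++ F) = W := ⟨_, rfl⟩
  have hWnodup : W.Nodup := hW ▸ hnodup.filter _
  have hWmem : ∀ x, x ∈ W ↔ G.Adj u x ∧ x ∉ u :: S ∧ x ∉ N ∧ x ∉ L ++ F := by
    simp [← hW, hmem]
  have hperm : ((W.filter (· ∈ T)).reverse ++ (W.filter (· ∉ T)).reverse).Perm W :=
    ((List.reverse_perm _).append (List.reverse_perm _)).trans <| by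
      simpa using W.filter_append_perm (· ∈ T)
  have hpush := h.push hWnodup hWmem hperm
  cases hb with
  | failure hT _ =>
    refine ⟨_, _, expand_false hk hW, hpush, ?_⟩
    obtain ⟨s, hs, hsu⟩ := h.adj_head
    have hNT : N ⊆ T := h.subset_of_isComponent hT
    refine hT.cons (List.mem_append_left T hs) hsu (List.nodup_reverse.2 (hWnodup.filter _)) ?_
    grind
  | success _ =>
    refine ⟨_, _, ?_, hpush.reopen, hpush.reopen.isComponent_of_nil⟩
    rw [expand_true hk hW, ← List.append_assoc]

/-- The specification of the pair `r` returned by a run of `Enumerate` or of its loop that starts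
with the output sequence `out`: the run restores the forbidden vertices `F`, outputs the sets in
`P`, and leaves behind a correct verdict about `S`. -/
structure IsOutcome (G : SimpleGraph V) (k : ℕ) (S F : List V) (out : List (Finset V))
    (P : Set (Finset V)) (r : State V × Bool) : Prop where
  F_eq : r.1.F = F
  outputs : Outputs P out r.1.out
  verdict : Verdict G k S F r.1.T r.2

/-- The correctness of all calls of `Enumerate` with a list `S` of length `n`. The second hypothesis
says that the tentative list `T` completes `S` to a component once the branching vertices `L` are
deleted as well. -/
def EnumerateCorrect (G : SimpleGraph V) (k : ℕ) (adj : V → List V) (n : ℕ) : Prop :=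
  ∀ ⦃S N L F T : List V⦄ ⦃out : List (Finset V)⦄, S.length = n → IsFrontier G S N L F →
    IsComponent G (S ++ T) (L ++ F) → (S ++ T).length ≤ k →
    IsOutcome G k S F out (solutions G k S F) (enumerate k adj ⟨S, N, L ++ F, T, out⟩ L.length)

theorem enumerate_of_length_eq {S N F T : List V} {out : List (Finset V)} {l : ℕ}
    (hS : S.length = k) :
    enumerate k adj ⟨S, N, F, T, out⟩ l = (⟨S, N, F, T, out ++ [S.toFinset]⟩, true) := by
  rw [enumerate, if_pos hS]

theorem enumerate_of_length_append_eq {S N F T : List V} {out : List (Finset V)} {l : ℕ}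
    (hS : S.length < k) (hST : (S ++ T).length = k) :
    enumerate k adj ⟨S, N, F, T, out⟩ l =
      enumerateLoop k adj ⟨S, N, F, [], out ++ [(S ++ T).toFinset]⟩ l true := by
  rw [enumerate, if_neg hS.ne, if_pos (by rwa [← List.length_append]), List.toFinset_append]

theorem enumerate_of_length_append_lt {S N F T : List V} {out : List (Finset V)} {l : ℕ}
    (hST : (S ++ T).length < k) :
    enumerate k adj ⟨S, N, F, T, out⟩ l = enumerateLoop k adj ⟨S, N, F, T, out⟩ l false := by
  rw [List.length_append] at hST
  rw [enumerate, if_neg (by dsimp only; omega), if_neg hST.ne]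

theorem IsFrontier.isOutcome_call (hadj : IsAdjacencyLists G adj) {S N L F T : List V}
    {out : List (Finset V)} {u : V} {b : Bool} {p : State V × ℕ}
    (h : IsFrontier G S N (u :: L) F) (hb : Verdict G k S (u :: (L ++ F)) T b) (hS : S.length < k)
    (hcall : S.length + 1 < k → EnumerateCorrect G k adj (S.length + 1))
    (hp : expand k adj u b ⟨u :: S, N, L ++ F, T, out⟩ = p) :
    IsOutcome G k (u :: S) (L ++ F) out (solutions G k (u :: S) (L ++ F))
      (enumerate k adj p.1 p.2) := by
  have hST := hb.length_add_length_lt hS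
  rcases Nat.lt_or_ge (S.length + 1) k with hk | hk
  · obtain ⟨N', L', hexpand, hfrontier, hcomp⟩ := h.exists_expand_eq hadj hb hk (out := out)
    obtain rfl := hexpand.symm.trans hp
    exact hcall hk rfl hfrontier hcomp (by simp only [List.length_append, List.length_cons]; omega)
  · obtain rfl := (expand_of_not_lt (by simpa using hk)).symm.trans hp
    have hSk : (u :: S).length = k := by simp only [List.length_cons]; omega
    obtain rfl : T = [] := List.eq_nil_of_length_eq_zero (by omega)
    obtain ⟨s, hs, hsu⟩ := h.adj_head
    have hconn := connected_induce_cons h.component.connected hs hsu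
    have hnodup : (u :: S ++ (L ++ F)).Nodup := by
      have := h.component.nodup
      simp only [List.nodup_append, List.nodup_cons, List.mem_append] at this ⊢
      grind
    have hsol := solutions_eq_singleton_of_length_eq hconn hnodup hSk
    rw [enumerate_of_length_eq hSk, hsol]
    exact ⟨rfl, outputs_singleton _ out, .success (hsol ▸ Set.singleton_nonempty _)⟩

theorem IsFrontier.isOutcome_enumerateLoop (hadj : IsAdjacencyLists G adj) {S N L F T : List V}
    {out : List (Finset V)} {b : Bool} (h : IsFrontier G S N L F)
    (hb : Verdict G k S (L ++ F) T b) (hS : S.length < k)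
    (hcall : S.length + 1 < k → EnumerateCorrect G k adj (S.length + 1)) :
    IsOutcome G k S F out (solutions G k S F \ solutions G k S (L ++ F))
      (enumerateLoop k adj ⟨S, N, L ++ F, T, out⟩ L.length b) := by
  induction L generalizing N T out b with
  | nil =>
    rw [List.length_nil, enumerateLoop, List.nil_append, sdiff_self]
    exact ⟨rfl, outputs_empty out, hb⟩
  | cons u L ih =>
    have houtcome := h.isOutcome_call hadj hb hS hcall (out := out) rfl
    rw [List.length_cons, List.cons_append, enumerateLoop]
    dsimp only
    generalize enumerate k adj _ _ = q at houtcome ⊢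
    obtain ⟨⟨_, _, _, T', out'⟩, b'⟩ := q
    obtain ⟨rfl, hout, hb'⟩ := houtcome
    have hrest := ih h.shift (h.verdict_step hS hb hb') (out := out')
    refine ⟨hrest.F_eq, ?_, hrest.verdict⟩
    rw [solutions_sdiff_solutions_cons S (L ++ F) F u (List.subset_append_right L F)]
    refine hout.trans hrest.outputs ?_
    exact Set.disjoint_sdiff_right.mono_left
      (solutions_anti (List.subset_cons_self u S) (List.Subset.refl _))

theorem enumerateCorrect (hadj : IsAdjacencyLists G adj) {n : ℕ} (hn : n < k) :
    EnumerateCorrect G k adj n := by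
  intro S N L F T out hSn h hT hTk
  subst hSn
  have hcall : S.length + 1 < k → EnumerateCorrect G k adj (S.length + 1) :=
    fun h => enumerateCorrect hadj h
  have hsub : S ⊆ S ++ T := List.subset_append_left S T
  rcases hTk.eq_or_lt with hTk | hTk
  · have hsol := hT.solutions_eq_singleton hsub h.component.ne_nil hTk
    have hloop := h.isOutcome_enumerateLoop hadj (.success (hsol ▸ Set.singleton_nonempty _)) hn
      hcall (out := out ++ [(S ++ T).toFinset])
    rw [enumerate_of_length_append_eq hn hTk]
    refine ⟨hloop.F_eq, ?_, hloop.verdict⟩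
    have houtputs := (outputs_singleton (S ++ T).toFinset out).trans hloop.outputs
      (hsol ▸ Set.disjoint_sdiff_right)
    rwa [← hsol, Set.union_sdiff_cancel
      (solutions_anti (List.Subset.refl S) (List.subset_append_right L F))] at houtputs
  · have hloop := h.isOutcome_enumerateLoop hadj (.failure hT hTk) hn hcall (out := out)
    rw [hT.solutions_eq_empty hsub h.component.ne_nil hTk, Set.sdiff_empty] at hloop
    rwa [enumerate_of_length_append_lt hTk]
termination_by k - n

end Enumerate

section Main

variable {V : Type*} [DecidableEq V] {G : SimpleGraph V} {k : ℕ} {adj : V → List V}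

theorem isOutcome_enumerate_singleton (hadj : IsAdjacencyLists G adj) (hk : 1 < k) {F : List V}
    {out : List (Finset V)} {v : V} (hF : F.Nodup) (hv : v ∉ F) :
    IsOutcome G k [v] F out (solutions G k [v] F)
      (enumerate k adj ⟨[v], [], ((adj v).filter (· ∉ F)).reverse ++ F, [], out⟩
        ((adj v).filter (· ∉ F)).length) := by
  obtain ⟨hnodup, hmem⟩ := hadj v
  have hcomp : IsComponent G [v] (((adj v).filter (· ∉ F)).reverse ++ F) :=
    isComponent_singleton hF hv (List.nodup_reverse.2 (hnodup.filter _)) (by simp [hmem])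
  have hfrontier : IsFrontier G [v] [] ((adj v).filter (· ∉ F)).reverse F :=
    ⟨hcomp, by simp_all⟩
  rw [← List.length_reverse (as := (adj v).filter (· ∉ F))]
  exact enumerateCorrect hadj hk rfl hfrontier hcomp hk.le

theorem outputs_mainLoop (hadj : IsAdjacencyLists G adj) (hk : 1 < k) {l F : List V}
    {out : List (Finset V)} (hl : IsConnectedOrder G l) (hF : F.Nodup)
    (hFl : ∀ x, x ∈ F ↔ x ∉ l) :
    Outputs (solutions G k [] F) out
      (mainLoop k adj (F.length + l.length) ⟨[], [], F, [], out⟩ l.reverse).out := by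
  induction l using List.reverseRecOn generalizing F out with
  | nil =>
    rw [solutions_eq_empty_of_forall_mem_or_mem (l := []) (by simp_all)
      (Nat.zero_lt_of_lt hk), List.reverse_nil, mainLoop]
    exact outputs_empty out
  | append_singleton l v ih =>
    have hv : v ∉ F := by simp [hFl]
    have hvl : v ∉ l := by
      have hnodup := hl.nodup
      grind
    have houtcome := isOutcome_enumerate_singleton hadj hk hF hv (out := out)
    have hsize : F.length + (l ++ [v]).length = (v :: F).length + l.length := by
      simp only [List.length_append, List.length_cons, List.length_nil]
      omega
    rw [List.reverse_concat, mainLoop, hsize]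
    dsimp only
    generalize enumerate k adj _ _ = q at houtcome ⊢
    obtain ⟨⟨_, _, _, T, out'⟩, b⟩ := q
    obtain ⟨rfl, hout, hverdict⟩ := houtcome
    rw [← solutions_cons_union_solutions_cons [] _ v]
    refine hout.trans ?_ (disjoint_solutions_cons _ _ _ _ v)
    split
    · rw [solutions_eq_empty_of_forall_mem_or_mem (l := l) (by grind) (by omega)]
      exact outputs_empty out'
    · -- The vertices that remain, with `v`, form a connected set, so the call has not failed.
      obtain rfl : T = [] :=
        hverdict.eq_nil (hl.connected _ List.prefix_rfl (by simp)) hl.nodup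
          (fun x hx => (hFl x).1 hx) List.mem_cons_self (by simp)
          (by simp only [List.length_append]; omega)
      exact ih (hl.of_prefix (List.prefix_append l [v])) (List.nodup_cons.2 ⟨hv, hF⟩) (by grind)

end Main

end ConnEnum

theorem lemma1_general {V : Type*} [DecidableEq V] (G : SimpleGraph V)
    (adj : V → List V) (hadj : ConnEnum.IsAdjacencyLists G adj)
    (order : List V) (horder : ConnEnum.IsConnectedOrder G order) (hmem : ∀ v, v ∈ order)
    (k : ℕ) (hk : 2 ≤ k) :
    (ConnEnum.main k adj order).Nodup ∧
      ∀ C : Finset V, C ∈ ConnEnum.main k adj order ↔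
        C.card = k ∧ (G.induce (C : Set V)).Connected := by
  obtain ⟨new, hmain, hnodup, hnew⟩ : ConnEnum.Outputs (ConnEnum.solutions G k [] []) []
      (ConnEnum.main k adj order) := by
    simpa only [ConnEnum.main, List.length_nil, Nat.zero_add] using
      ConnEnum.outputs_mainLoop hadj hk horder List.nodup_nil (F := []) (by simp [hmem])
  rw [hmain, List.nil_append]
  exact ⟨hnodup, fun C => (hnew C).trans ConnEnum.mem_solutions_nil_nil⟩

theorem lemma1 {V : Type*} [Fintype V] [DecidableEq V] (G : SimpleGraph V) (hG : G.Connected)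
    (adj : V → List V) (hadj : ConnEnum.IsAdjacencyLists G adj)
    (order : List V) (horder : ConnEnum.IsDFSOrder G order)
    (k : ℕ) (hk : 2 ≤ k) :
    (ConnEnum.main k adj order).Nodup ∧
      ∀ C : Finset V, C ∈ ConnEnum.main k adj order ↔
        C.card = k ∧ (G.induce (C : Set V)).Connected :=
  lemma1_general G adj hadj order horder.isConnectedOrder (horder.mem hG) k hk
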